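/- Let $p$ be a prime and let $m\ge 2$, $n\ge 1$ be integers, with $m\ge 3$ if $p=2$. Let $G$ be a minimal non-abelian $p$-group (that is, $G$ is non-abelian but every proper subgroup of $G$ is abelian) such that $$G\cong\langle a,b\mid a^{p^m}=1,\ b^{p^n}=1,\ [a,b]=a^{p^{m-1}},\ [a,b,a]=[a,b,b]=1\rangle ,$$ where $[x,y]=xyx^{-1}y^{-1}$ and $[x,y,z]=[[x,y],z]$. Suppose that $G/G'$ is homocyclic, i.e. a direct product of finitely many cyclic groups of the same order. Then $n=m-1$; the group $G$ is not capable, i.e. there is no group $H$ with $G\cong H/Z(H)$; and $Z^{\wedge}(G)=G'$. Here $Z^{\wedge}(G)=\{g\in G: g\wedge h=1 \text{ in } G\wedge G \text{ for all } h\in G\}$ is the exterior center of $G$, and $G\wedge G$ is the non-abelian exterior square, the group generated by the symbols $g\wedge h$ ($g,h\in G$) subject to the relations $gg'\wedge h=({}^{g}g'\wedge{}^{g}h)(g\wedge h)$, $g\wedge hh'=(g\wedge h)({}^{h}g\wedge{}^{h}h')$ and $g\wedge g=1$ for all $g,g',h,h'\in G$, where ${}^{x}y=xyx^{-1}$. 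-/

import Mathlib

open scoped commutatorElement

universe u v

/-- A group is minimal non-abelian if it is not abelian but each of its proper subgroups is. -/
def IsMinimalNonabelian (G : Type*) [Group G] : Prop :=
  (¬ ∀ x y : G, x * y = y * x) ∧
    ∀ K : Subgroup G, K ≠ ⊤ → ∀ x ∈ K, ∀ y ∈ K, x * y = y * x

/-- A group is homocyclic (of finite rank) if it is a direct product of finitely many cyclic
groups of the same order. -/
def IsHomocyclic (A : Type*) [Group A] : Prop :=
  ∃ k d : ℕ, Nonempty (A ≃* Multiplicative (Fin d → ZMod k))

/-- A group `G` is capable if `G ≅ H / Z(H)` for some group `H`. -/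
def IsCapable (G : Type u) [Group G] : Prop :=
  ∃ (H : Type v) (_ : Group H), Nonempty (G ≃* H ⧸ Subgroup.center H)

/-- The defining relators of the non-abelian exterior square `G ∧ G`, on the symbols
`g ∧ h = (g, h)`. Here `ᵍx = g x g⁻¹`:
`gg' ∧ h = (ᵍg' ∧ ᵍh) (g ∧ h)`, `g ∧ hh' = (g ∧ h) (ʰg ∧ ʰh')` and `g ∧ g = 1`. -/
inductive ExteriorRelator (G : Type*) [Group G] : FreeGroup (G × G) → Prop
  | mul_left (g g' h : G) : ExteriorRelator G
      (FreeGroup.of (g * g', h) *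
        (FreeGroup.of (g * g' * g⁻¹, g * h * g⁻¹) * FreeGroup.of (g, h))⁻¹)
  | mul_right (g h h' : G) : ExteriorRelator G
      (FreeGroup.of (g, h * h') *
        (FreeGroup.of (g, h) * FreeGroup.of (h * g * h⁻¹, h * h' * h⁻¹))⁻¹)
  | diag (g : G) : ExteriorRelator G (FreeGroup.of (g, g))

/-- The non-abelian exterior square `G ∧ G`. -/
abbrev ExteriorSquare (G : Type*) [Group G] : Type _ :=
  PresentedGroup {r : FreeGroup (G × G) | ExteriorRelator G r}

/-- The element `g ∧ h` of the non-abelian exterior square. -/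
def wedge {G : Type*} [Group G] (g h : G) : ExteriorSquare G :=
  PresentedGroup.of (g, h)

/-- The exterior center `Z^∧(G)`: all `g` with `g ∧ h = 1` for every `h`. -/
def exteriorCenter (G : Type*) [Group G] : Set G :=
  {g | ∀ h : G, wedge g h = 1}

/-- The group `⟨a, b ∣ a^(p^m) = b^(p^n) = 1, [a,b] = a^(p^(m-1)), [a,b,a] = [a,b,b] = 1⟩`,
where `a = of 0`, `b = of 1`, `[x,y] = x y x⁻¹ y⁻¹` and `[x,y,z] = [[x,y],z]`. -/
abbrev MetacyclicMinimal (p m n : ℕ) : Type :=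
  let a : FreeGroup (Fin 2) := FreeGroup.of 0
  let b : FreeGroup (Fin 2) := FreeGroup.of 1
  PresentedGroup
    ({a ^ p ^ m, b ^ p ^ n, ⁅a, b⁆ * (a ^ p ^ (m - 1))⁻¹, ⁅⁅a, b⁆, a⁆, ⁅⁅a, b⁆, b⁆} :
      Set (FreeGroup (Fin 2)))

/-!
Write `q = p ^ (m - 1)` and `c = ⁅a, b⁆ = a ^ q`, a central element generating `G'`.

*The exponents agree.* `G/G'` is generated by the images of `a` and `b`, of orders `p ^ (m - 1)` and
`p ^ n`. In a homocyclic group having `ZMod (p ^ t)` as an image, every element of order dividing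
`p ^ s` with `s < t` is a `p`-th power (`IsHomocyclic.exists_pow_eq`), whereas neither generator of
`G/G'` is a `p`-th power. Hence `n = m - 1`.

*`G'` lies in the exterior center.* Put `w = a ∧ b`. Expanding the first argument gives
`a ^ k ∧ b = w ^ k`, so `t = c ∧ b = w ^ q` and `t ^ p = a ^ (p ^ m) ∧ b = 1`. Expanding the second
argument gives `(a ∧ b ^ k) * t ^ (k.choose 2) = w ^ k`, because conjugation by `b` sends `w` to
`w * t⁻¹`. For `k = q = p ^ n` both factors on the left are trivial, as `p` divides `q.choose 2`
(this is where `m ≥ 3` is needed if `p = 2`), and so `t = w ^ q = 1`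
(`wedge_pow_eq_one_of_metacyclic`). As `c ∧ a = 1` too, `c` is in the exterior center.

*The exterior center lies in `G'`.* As `n = m - 1`, both coordinates `α`, `β` of `G/G'` take values
in `ZMod q`, and `g ∧ h ↦ α g * β h - β g * α h` is a well-defined homomorphism on `G ∧ G`. Pairing
`g` with `a` and `b` shows that both coordinates of an element of the exterior center vanish.

*`G` is not capable.* If `G ≅ H / Z(H)`, commutators of lifts define a homomorphism `G ∧ G → H`, so
lifts of elements of the exterior center are central in `H`: the exterior center of a capable group
is trivial. But `G' ≠ 1`.
-/

/-! ### The non-abelian exterior square -/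

section ExteriorSquare

variable {G : Type*} [Group G]

theorem wedge_mul_left_conj (g g' h : G) :
    wedge (g * g') h = wedge (g * g' * g⁻¹) (g * h * g⁻¹) * wedge g h := by
  have := PresentedGroup.one_of_mem (rels := {r | ExteriorRelator G r})
    (ExteriorRelator.mul_left g g' h)
  rw [map_mul, map_inv, map_mul, mul_inv_eq_one] at this
  exact this

theorem wedge_mul_right_conj (g h h' : G) :
    wedge g (h * h') = wedge g h * wedge (h * g * h⁻¹) (h * h' * h⁻¹) := by
  have := PresentedGroup.one_of_mem (rels := {r | ExteriorRelator G r})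
    (ExteriorRelator.mul_right g h h')
  rw [map_mul, map_inv, map_mul, mul_inv_eq_one] at this
  exact this

@[simp]
theorem wedge_self (g : G) : wedge g g = 1 :=
  PresentedGroup.one_of_mem (rels := {r | ExteriorRelator G r}) (ExteriorRelator.diag g)

/-- The homomorphism out of `G ∧ G` induced by a map `f : G → G → K` which satisfies the defining
relations. -/
def ExteriorSquare.lift {K : Type*} [Group K] (f : G → G → K)
    (hl : ∀ g g' h, f (g * g') h = f (g * g' * g⁻¹) (g * h * g⁻¹) * f g h)
    (hr : ∀ g h h', f g (h * h') = f g h * f (h * g * h⁻¹) (h * h' * h⁻¹))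
    (hd : ∀ g, f g g = 1) : ExteriorSquare G →* K :=
  PresentedGroup.toGroup (f := fun x : G × G => f x.1 x.2) (by
    rintro _ (⟨g, g', h⟩ | ⟨g, h, h'⟩ | ⟨g⟩)
    · simp only [map_mul, map_inv, FreeGroup.lift_apply_of]
      rw [mul_inv_eq_one]; exact hl g g' h
    · simp only [map_mul, map_inv, FreeGroup.lift_apply_of]
      rw [mul_inv_eq_one]; exact hr g h h'
    · simpa only [FreeGroup.lift_apply_of] using hd g)

@[simp]
theorem ExteriorSquare.lift_wedge {K : Type*} [Group K] (f : G → G → K) (hl hr hd) (g h : G) :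
    ExteriorSquare.lift f hl hr hd (wedge g h) = f g h :=
  PresentedGroup.toGroup.of _

/-- The action of `x : G` on `G ∧ G` by conjugation of both entries. -/
def ExteriorSquare.conj (x : G) : ExteriorSquare G →* ExteriorSquare G :=
  ExteriorSquare.lift (fun g h => wedge (x * g * x⁻¹) (x * h * x⁻¹))
    (fun g g' h => by
      have := wedge_mul_left_conj (x * g * x⁻¹) (x * g' * x⁻¹) (x * h * x⁻¹)
      simpa only [mul_assoc, mul_inv_rev, inv_inv, inv_mul_cancel_left] using this)
    (fun g h h' => by
      have := wedge_mul_right_conj (x * g * x⁻¹) (x * h * x⁻¹) (x * h' * x⁻¹)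
      simpa only [mul_assoc, mul_inv_rev, inv_inv, inv_mul_cancel_left] using this)
    (fun _ => wedge_self _)

@[simp]
theorem ExteriorSquare.conj_wedge (x g h : G) :
    ExteriorSquare.conj x (wedge g h) = wedge (x * g * x⁻¹) (x * h * x⁻¹) :=
  ExteriorSquare.lift_wedge ..

theorem wedge_mul_left (g g' h : G) :
    wedge (g * g') h = ExteriorSquare.conj g (wedge g' h) * wedge g h := by
  rw [ExteriorSquare.conj_wedge, wedge_mul_left_conj]

theorem wedge_mul_right (g h h' : G) :
    wedge g (h * h') = wedge g h * ExteriorSquare.conj h (wedge g h') := by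
  rw [ExteriorSquare.conj_wedge, wedge_mul_right_conj]

@[simp]
theorem one_wedge (h : G) : wedge 1 h = 1 := by
  simpa using wedge_mul_left_conj 1 1 h

@[simp]
theorem wedge_one (g : G) : wedge g 1 = 1 := by
  simpa using wedge_mul_right_conj g 1 1

theorem wedge_pow_self (g : G) (k : ℕ) : wedge g (g ^ k) = 1 := by
  induction k with
  | zero => simp
  | succ k ih => simp [pow_succ', wedge_mul_right, ih]

theorem pow_wedge_self (g : G) (k : ℕ) : wedge (g ^ k) g = 1 := by
  induction k with
  | zero => simp
  | succ k ih => simp [pow_succ', wedge_mul_left, ih]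

theorem pow_wedge_eq_one {g h : G} (hgh : wedge g h = 1) (k : ℕ) :
    wedge (g ^ k) h = 1 := by
  induction k with
  | zero => simp
  | succ k ih =>
    rw [pow_succ, wedge_mul_left, hgh, map_one, one_mul, ih]

theorem conj_wedge_of_mem_center {c : G} (hc : c ∈ Subgroup.center G) (g h : G) :
    ExteriorSquare.conj c (wedge g h) = wedge g h := by
  rw [Subgroup.mem_center_iff] at hc
  rw [ExteriorSquare.conj_wedge, ← hc g, ← hc h, mul_inv_cancel_right, mul_inv_cancel_right]

/-- The subgroup of all `h` with `c ∧ h = 1`. -/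
def wedgeAnnihilator (c : G) : Subgroup G where
  carrier := {h | wedge c h = 1}
  one_mem' := wedge_one c
  mul_mem' := by
    intro x y (hx : wedge c x = 1) (hy : wedge c y = 1)
    change wedge c (x * y) = 1
    rw [wedge_mul_right, hx, hy, map_one, one_mul]
  inv_mem' := by
    intro x (hx : wedge c x = 1)
    change wedge c x⁻¹ = 1
    have h : wedge c (x⁻¹ * x) = 1 := by rw [inv_mul_cancel, wedge_one]
    rwa [wedge_mul_right, hx, map_one, mul_one] at h

theorem mem_exteriorCenter_of_closure {c : G} {s : Set G}
    (hs : Subgroup.closure s = ⊤) (h : ∀ x ∈ s, wedge c x = 1) : c ∈ exteriorCenter G := by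
  intro x
  have hle : Subgroup.closure s ≤ wedgeAnnihilator c := (Subgroup.closure_le _).2 h
  exact hle (hs ▸ Subgroup.mem_top x)

/-- Commutators of lifts to `H` define a homomorphism `H/Z(H) ∧ H/Z(H) → H`, so lifts of elements of
the exterior center commute with everything. -/
theorem IsCapable.eq_one_of_mem_exteriorCenter {G : Type u} [Group G] (hG : IsCapable.{u, v} G)
    {g : G} (hg : g ∈ exteriorCenter G) : g = 1 := by
  obtain ⟨H, _, ⟨e⟩⟩ := hG
  let π : H →* G := e.symm.toMonoidHom.comp (QuotientGroup.mk' (Subgroup.center H))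
  have hπ : Function.Surjective π := e.symm.surjective.comp (QuotientGroup.mk'_surjective _)
  have hker : ∀ x, π x = 1 ↔ x ∈ Subgroup.center H := fun x => by
    simp [π]
  let s : G → H := Function.surjInv hπ
  have hs : ∀ x, π (s x) = x := Function.surjInv_eq hπ
  have hwd : ∀ x x' y y' : H, π x = π x' → π y = π y' → ⁅x, y⁆ = ⁅x', y'⁆ := by
    intro x x' y y' hx hy
    have h1 : x'⁻¹ * x ∈ Subgroup.center H := by
      rw [← hker, map_mul, map_inv, hx, inv_mul_cancel]
    have h2 : y'⁻¹ * y ∈ Subgroup.center H := by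
      rw [← hker, map_mul, map_inv, hy, inv_mul_cancel]
    obtain ⟨z, rfl⟩ : ∃ z, x = x' * z := ⟨x'⁻¹ * x, by group⟩
    obtain ⟨z', rfl⟩ : ∃ z', y = y' * z' := ⟨y'⁻¹ * y, by group⟩
    rw [inv_mul_cancel_left, Subgroup.mem_center_iff] at h1 h2
    calc ⁅x' * z, y' * z'⁆ = x' * (z * (y' * z') * z⁻¹) * x'⁻¹ * (y' * z')⁻¹ := by
          rw [commutatorElement_def]; group
      _ = x' * y' * (z' * x'⁻¹ * z'⁻¹) * y'⁻¹ := by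
          rw [← h1 (y' * z'), mul_inv_cancel_right]; group
      _ = ⁅x', y'⁆ := by
          rw [← h2, mul_inv_cancel_right, commutatorElement_def]
  let f : ExteriorSquare G →* H := ExteriorSquare.lift (fun x y => ⁅s x, s y⁆)
    (fun g g' h => by
      rw [hwd (s (g * g')) (s g * s g') (s h) (s h) (by simp [hs]) rfl,
        hwd (s (g * g' * g⁻¹)) (s g * s g' * (s g)⁻¹) (s (g * h * g⁻¹)) (s g * s h * (s g)⁻¹)
          (by simp [hs]) (by simp [hs])]
      simp only [commutatorElement_def]; group)
    (fun g h h' => by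
      rw [hwd (s g) (s g) (s (h * h')) (s h * s h') rfl (by simp [hs]),
        hwd (s (h * g * h⁻¹)) (s h * s g * (s h)⁻¹) (s (h * h' * h⁻¹)) (s h * s h' * (s h)⁻¹)
          (by simp [hs]) (by simp [hs])]
      simp only [commutatorElement_def]; group)
    (fun g => commutatorElement_self _)
  rw [← hs g, hker, Subgroup.mem_center_iff]
  intro y
  have h1 : ⁅s g, s (π y)⁆ = 1 := by
    have := congrArg f (hg (π y))
    rwa [map_one, ExteriorSquare.lift_wedge] at this
  rw [hwd _ (s g) _ y rfl (hs _)] at h1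
  exact (commutatorElement_eq_one_iff_mul_comm.1 h1).symm

/-- An alternating form on the abelianization gives a homomorphism on `G ∧ G`, so the exterior
center pairs trivially with every element. -/
theorem alternating_eq_zero_of_mem_exteriorCenter {R : Type*} [CommRing R]
    (α β : G →* Multiplicative R) {g : G} (hg : g ∈ exteriorCenter G) (h : G) :
    (α g).toAdd * (β h).toAdd - (β g).toAdd * (α h).toAdd = 0 := by
  let f : ExteriorSquare G →* Multiplicative R := ExteriorSquare.lift
    (fun x y => Multiplicative.ofAdd
      ((α x).toAdd * (β y).toAdd - (β x).toAdd * (α y).toAdd))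
    (fun g g' h => by
      rw [← ofAdd_add]
      congr 1
      simp only [map_mul, map_inv, toAdd_mul, toAdd_inv]
      ring)
    (fun g h h' => by
      rw [← ofAdd_add]
      congr 1
      simp only [map_mul, map_inv, toAdd_mul, toAdd_inv]
      ring)
    (fun g => by rw [mul_comm, sub_self, ofAdd_zero])
  have := congrArg f (hg h)
  rwa [map_one, ExteriorSquare.lift_wedge, ofAdd_eq_one] at this

/-- If `⁅a, b⁆ = a ^ p ^ n` is central of order dividing `p` and `b ^ p ^ n = 1`, then
`a ^ p ^ n ∧ b = 1`, except possibly when `p ^ n = 2`. -/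
theorem wedge_pow_eq_one_of_metacyclic {p n : ℕ} (hp : p.Prime) (h2 : p ^ n ≠ 2) {a b : G}
    (ha : a ^ p ^ (n + 1) = 1) (hb : b ^ p ^ n = 1) (hab : ⁅a, b⁆ = a ^ p ^ n)
    (hc : a ^ p ^ n ∈ Subgroup.center G) : wedge (a ^ p ^ n) b = 1 := by
  set q := p ^ n with hq
  set w := wedge a b with hw
  have hconj_a : ExteriorSquare.conj a w = w := by
    have h1 : a * b * a⁻¹ = a ^ q * b := by
      rw [← hab, commutatorElement_def, inv_mul_cancel_right]
    rw [hw, ExteriorSquare.conj_wedge, mul_inv_cancel_right, h1, wedge_mul_right, wedge_pow_self,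
      conj_wedge_of_mem_center hc, one_mul]
  have hpow_left : ∀ k : ℕ, wedge (a ^ k) b = w ^ k := by
    intro k
    induction k with
    | zero => simp
    | succ k ih => rw [pow_succ', wedge_mul_left, ih, map_pow, hconj_a, pow_succ]
  set t := wedge (a ^ q) b with ht
  have htw : t = w ^ q := hpow_left q
  have hcomm : Commute w t := htw ▸ Commute.self_pow w q
  have htp : t ^ p = 1 := by
    rw [htw, ← pow_mul, hq, ← pow_succ, ← hpow_left, ha, one_wedge]
  have hconj_b : ExteriorSquare.conj b w = w * t⁻¹ := by
    have h1 : a ^ q * (b * a * b⁻¹) = a := by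
      rw [← hab, commutatorElement_def]; group
    have h2 : ExteriorSquare.conj b w = wedge (b * a * b⁻¹) b := by
      rw [hw, ExteriorSquare.conj_wedge, mul_inv_cancel_right]
    rw [eq_mul_inv_iff_mul_eq, h2, ht, ← conj_wedge_of_mem_center hc (b * a * b⁻¹) b,
      ← wedge_mul_left, h1]
  have hconj_t : ExteriorSquare.conj b t = t := by
    rw [ht, ExteriorSquare.conj_wedge, mul_inv_cancel_right, Subgroup.mem_center_iff.1 hc b,
      mul_inv_cancel_right]
  have hpow_right : ∀ k : ℕ, wedge a (b ^ k) * t ^ k.choose 2 = w ^ k := by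
    intro k
    induction k with
    | zero => simp
    | succ k ih =>
      have h := congrArg (ExteriorSquare.conj b) ih
      rw [map_mul, map_pow, map_pow, hconj_t, hconj_b, (hcomm.inv_right).mul_pow, inv_pow,
        eq_mul_inv_iff_mul_eq, mul_assoc, ← pow_add] at h
      rw [pow_succ', wedge_mul_right, Nat.choose_succ_succ', Nat.choose_one_right, add_comm k,
        mul_assoc, h, ← hw, ← pow_succ']
  have hfin := hpow_right q
  obtain ⟨d, hd⟩ : p ∣ q.choose 2 := hp.dvd_choose_pow (by norm_num) (Ne.symm h2)
  rw [hb, wedge_one, one_mul, hd, pow_mul, htp, one_pow] at hfin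
  rw [htw, hfin]

end ExteriorSquare

/-! ### Homocyclic groups -/

theorem ZMod.exists_eq_mul_of_pow_mul_eq_zero {p s t k : ℕ} (hp : p.Prime) (hst : s < t)
    (hk : p ^ t ∣ k) (x : ZMod k) (hx : (p : ZMod k) ^ s * x = 0) :
    ∃ c : ZMod k, x = p * c := by
  obtain ⟨i, rfl⟩ := ZMod.intCast_surjective x
  have h1 : (k : ℤ) ∣ (p : ℤ) ^ s * i := by
    rw [← ZMod.intCast_zmod_eq_zero_iff_dvd]
    exact_mod_cast hx
  have h2 : (p : ℤ) ^ s * p ∣ (p : ℤ) ^ s * i := by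
    rw [← pow_succ]
    refine dvd_trans ?_ h1
    exact_mod_cast (pow_dvd_pow p hst).trans hk
  obtain ⟨c, rfl⟩ := Int.dvd_of_mul_dvd_mul_left
    (pow_ne_zero s (Int.natCast_ne_zero.2 hp.ne_zero)) h2
  exact ⟨c, by push_cast; rfl⟩

/-- In a homocyclic group whose exponent is divisible by `p ^ t`, each element of order dividing
`p ^ s`, `s < t`, is a `p`-th power. -/
theorem IsHomocyclic.exists_pow_eq {A : Type*} [Group A] (hA : IsHomocyclic A) {p s t : ℕ}
    (hp : p.Prime) (hst : s < t) (f : A →* Multiplicative (ZMod (p ^ t))) {y : A}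
    (hy : f y = Multiplicative.ofAdd 1) {x : A} (hx : x ^ p ^ s = 1) : ∃ c : A, c ^ p = x := by
  obtain ⟨k, d, ⟨e⟩⟩ := hA
  have hk : p ^ t ∣ k := by
    have h1 : y ^ k = 1 := by
      apply e.injective
      rw [map_pow, map_one]
      apply Multiplicative.toAdd.injective
      rw [toAdd_pow, toAdd_one]
      ext i
      simp
    have h2 : f y ^ k = 1 := by rw [← map_pow, h1, map_one]
    rw [hy, ← ofAdd_nsmul, ofAdd_eq_one, nsmul_one] at h2
    exact (ZMod.natCast_eq_zero_iff _ _).1 h2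
  have hz : ∀ i, ∃ c : ZMod k, (e x).toAdd i = p * c := by
    intro i
    refine ZMod.exists_eq_mul_of_pow_mul_eq_zero hp hst hk _ ?_
    have h1 := congrArg (fun z => (e z).toAdd i) hx
    simpa [nsmul_eq_mul] using h1
  choose c hc using hz
  refine ⟨e.symm (Multiplicative.ofAdd c), ?_⟩
  apply e.injective
  rw [map_pow, e.apply_symm_apply]
  apply Multiplicative.toAdd.injective
  rw [toAdd_pow, toAdd_ofAdd]
  ext i
  rw [Pi.smul_apply, nsmul_eq_mul, hc]

theorem pow_prime_ne_of_map_eq_one {A : Type*} [Group A] {p s : ℕ} (hp : p.Prime) (hs : 1 ≤ s)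
    (g : A →* Multiplicative (ZMod (p ^ s))) {x : A} (hx : g x = Multiplicative.ofAdd 1) (c : A) :
    c ^ p ≠ x := by
  rintro rfl
  have h1 : p • (g c).toAdd = 1 := by
    rw [← toAdd_pow, ← map_pow, hx, toAdd_ofAdd]
  -- Reduction modulo `p` turns `p • c = 1` into `0 = 1`.
  have h2 := congrArg (ZMod.castHom (dvd_pow_self p (by omega : s ≠ 0)) (ZMod p)) h1
  rw [map_nsmul, map_one, nsmul_eq_mul, CharP.cast_eq_zero, zero_mul] at h2
  have : Fact p.Prime := ⟨hp⟩
  exact zero_ne_one h2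

/-- If `s < t`, then `x` would be a `p`-th power by `IsHomocyclic.exists_pow_eq`, contradicting
`g x = 1` in `ZMod (p ^ s)`. -/
theorem IsHomocyclic.le_of_coordinates {A : Type*} [Group A] (hA : IsHomocyclic A) {p s t : ℕ}
    (hp : p.Prime) (hs : 1 ≤ s) (f : A →* Multiplicative (ZMod (p ^ t)))
    (g : A →* Multiplicative (ZMod (p ^ s))) {x y : A} (hy : f y = Multiplicative.ofAdd 1)
    (hx : g x = Multiplicative.ofAdd 1) (hxs : x ^ p ^ s = 1) : t ≤ s := by
  by_contra! hst
  obtain ⟨c, hc⟩ := hA.exists_pow_eq hp hst f hy hxs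
  exact pow_prime_ne_of_map_eq_one hp hs g hx c hc

/-! ### Groups generated by two elements -/

section TwoGenerators

variable {G : Type*} [Group G] {a b : G}

theorem mem_center_of_closure_pair (hgen : Subgroup.closure {a, b} = ⊤) {c : G}
    (ha : c * a = a * c) (hb : c * b = b * c) : c ∈ Subgroup.center G := by
  have hle : Subgroup.closure {a, b} ≤ Subgroup.centralizer {c} := by
    rw [Subgroup.closure_le]
    rintro x (rfl | rfl)
    · exact Subgroup.mem_centralizer_singleton_iff.2 ha.symm
    · exact Subgroup.mem_centralizer_singleton_iff.2 hb.symm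
  rw [Subgroup.mem_center_iff]
  intro x
  exact Subgroup.mem_centralizer_singleton_iff.1 (hle (hgen ▸ Subgroup.mem_top x))

theorem commutator_le_of_closure_pair (hgen : Subgroup.closure {a, b} = ⊤) {N : Subgroup G}
    [N.Normal] (h : ⁅a, b⁆ ∈ N) : commutator G ≤ N := by
  let π := QuotientGroup.mk' N
  have hπ : Function.Surjective π := QuotientGroup.mk'_surjective N
  have hgen' : Subgroup.closure {π a, π b} = ⊤ := by
    rw [← Set.image_pair, ← MonoidHom.map_closure, hgen, Subgroup.map_top_of_surjective π hπ]
  have hab : π a * π b = π b * π a := by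
    rw [← commutatorElement_eq_one_iff_mul_comm, ← map_commutatorElement]
    exact (QuotientGroup.eq_one_iff _).2 h
  have hcenter : Subgroup.center (G ⧸ N) = ⊤ := by
    rw [eq_top_iff, ← hgen', Subgroup.closure_le]
    rintro x (rfl | rfl)
    · exact mem_center_of_closure_pair hgen' rfl hab
    · exact mem_center_of_closure_pair hgen' hab.symm rfl
  rw [commutator_def, Subgroup.commutator_le]
  intro x _ y _
  rw [← QuotientGroup.eq_one_iff]
  change π ⁅x, y⁆ = 1
  rw [map_commutatorElement, commutatorElement_eq_one_iff_mul_comm]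
  exact Subgroup.mem_center_iff.1 (hcenter ▸ Subgroup.mem_top (π y)) (π x)

/-- If coordinates `α`, `β` modulo `q` are dual to `a`, `b`, and both `a ^ q` and `b ^ q` lie in
`G'`, then `G'` is the common kernel of `α` and `β`. -/
theorem mem_commutator_of_coordinates_eq_one (hgen : Subgroup.closure {a, b} = ⊤) {q : ℕ}
    (ha : a ^ q ∈ commutator G) (hb : b ^ q ∈ commutator G)
    (α β : G →* Multiplicative (ZMod q))
    (hαa : α a = Multiplicative.ofAdd 1) (hαb : α b = 1)
    (hβa : β a = 1) (hβb : β b = Multiplicative.ofAdd 1)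
    {g : G} (hα : α g = 1) (hβ : β g = 1) : g ∈ commutator G := by
  have hgen' : Subgroup.closure {Abelianization.of a, Abelianization.of b} = ⊤ := by
    rw [← Set.image_pair, ← MonoidHom.map_closure, hgen]
    exact Subgroup.map_top_of_surjective _ (QuotientGroup.mk'_surjective _)
  have hof : ∀ x : G, Abelianization.of x = 1 ↔ x ∈ commutator G := fun x => by
    rw [← MonoidHom.mem_ker, Abelianization.ker_of]
  have hpow : ∀ (x : G) (i : ℤ), x ^ q ∈ commutator G → ((i : ZMod q) = 0) →
      Abelianization.of x ^ i = 1 := by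
    intro x i hx hi
    obtain ⟨j, rfl⟩ := (ZMod.intCast_zmod_eq_zero_iff_dvd i q).1 hi
    rw [zpow_mul, zpow_natCast, ← map_pow, (hof _).2 hx, one_zpow]
  obtain ⟨i, j, hij⟩ := Subgroup.mem_closure_pair.1
    (hgen' ▸ Subgroup.mem_top (Abelianization.of g))
  have hi : (i : ZMod q) = 0 := by
    have := congrArg (Abelianization.lift α) hij
    rw [map_mul, map_zpow, map_zpow] at this
    simp only [Abelianization.lift_apply_of, hαa, hαb, hα, one_zpow, mul_one] at this
    rwa [← ofAdd_zsmul, ofAdd_eq_one, zsmul_one] at this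
  have hj : (j : ZMod q) = 0 := by
    have := congrArg (Abelianization.lift β) hij
    rw [map_mul, map_zpow, map_zpow] at this
    simp only [Abelianization.lift_apply_of, hβa, hβb, hβ, one_zpow, one_mul] at this
    rwa [← ofAdd_zsmul, ofAdd_eq_one, zsmul_one] at this
  rw [← hof, ← hij, hpow a i ha hi, hpow b j hb hj, one_mul]

end TwoGenerators

/-! ### The metacyclic group -/

/-- The homomorphism to an abelian group that sends the generators to `x` and `y`. -/
def MetacyclicMinimal.lift {p m n : ℕ} {A : Type*} [CommGroup A] (x y : A)
    (hx : x ^ p ^ (m - 1) = 1) (hy : y ^ p ^ n = 1) :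
    MetacyclicMinimal p m n →* A :=
  PresentedGroup.toGroup (f := ![x, y]) (by
    have hxm : x ^ p ^ m = 1 := by
      obtain ⟨c, hc⟩ := pow_dvd_pow p (Nat.sub_le m 1)
      rw [hc, pow_mul, hx, one_pow]
    rintro _ (rfl | rfl | rfl | rfl | rfl) <;>
      simp [hx, hxm, hy, commutatorElement_def])

theorem MetacyclicMinimal.relations (p m n : ℕ) :
    let a : MetacyclicMinimal p m n := PresentedGroup.of 0
    let b : MetacyclicMinimal p m n := PresentedGroup.of 1
    a ^ p ^ m = 1 ∧ b ^ p ^ n = 1 ∧ ⁅a, b⁆ = a ^ p ^ (m - 1) ∧ ⁅⁅a, b⁆, b⁆ = 1 := by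
  refine ⟨PresentedGroup.one_of_mem (Or.inl rfl), PresentedGroup.one_of_mem (Or.inr (Or.inl rfl)),
    mul_inv_eq_one.1 (PresentedGroup.one_of_mem (Or.inr (Or.inr (Or.inl rfl)))),
    PresentedGroup.one_of_mem (Or.inr (Or.inr (Or.inr (Or.inr rfl))))⟩

theorem mainTheorem11 (p : ℕ) (hp : p.Prime) (m n : ℕ) (hm : 2 ≤ m) (hn : 1 ≤ n)
    (hm2 : p = 2 → 3 ≤ m) (G : Type u) [Group G] (hpG : IsPGroup p G)
    (hmin : IsMinimalNonabelian G) (hG : Nonempty (G ≃* MetacyclicMinimal p m n))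
    (hhom : IsHomocyclic (G ⧸ commutator G)) :
    n = m - 1 ∧ ¬ IsCapable.{u, v} G ∧ exteriorCenter G = (commutator G : Set G) := by
  obtain ⟨e⟩ := hG
  obtain ⟨s, rfl⟩ : ∃ s, m = s + 1 := ⟨m - 1, by omega⟩
  rw [Nat.add_sub_cancel]
  let M := MetacyclicMinimal p (s + 1) n
  let A : M := PresentedGroup.of 0
  let B : M := PresentedGroup.of 1
  set a : G := e.symm A with ha_def
  set b : G := e.symm B with hb_def
  obtain ⟨hA, hB, hAB, hCB⟩ := MetacyclicMinimal.relations p (s + 1) n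
  have ha : a ^ p ^ (s + 1) = 1 := by rw [ha_def, ← map_pow, hA, map_one]
  have hb : b ^ p ^ n = 1 := by rw [hb_def, ← map_pow, hB, map_one]
  have hab : ⁅a, b⁆ = a ^ p ^ s := by
    rw [ha_def, hb_def, ← map_commutatorElement, hAB, map_pow]
    rfl
  have hcb : ⁅⁅a, b⁆, b⁆ = 1 := by
    rw [ha_def, hb_def, ← map_commutatorElement, ← map_commutatorElement, hCB, map_one]
  have hgen : Subgroup.closure {a, b} = ⊤ := by
    have h1 : Set.range (PresentedGroup.of : Fin 2 → M) = {A, B} := by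
      ext x
      simp [Fin.exists_fin_two, A, B, eq_comm]
    have h2 : Subgroup.closure {A, B} = (⊤ : Subgroup M) := by
      rw [← h1]; exact PresentedGroup.closure_range_of _
    have h3 := congrArg (Subgroup.map e.symm.toMonoidHom) h2
    rw [MonoidHom.map_closure, Set.image_pair,
      Subgroup.map_top_of_surjective _ e.symm.surjective] at h3
    exact h3
  have hcenter : a ^ p ^ s ∈ Subgroup.center G := by
    refine mem_center_of_closure_pair hgen (by rw [← pow_succ, ← pow_succ']) ?_
    rw [← hab]
    exact commutatorElement_eq_one_iff_mul_comm.1 hcb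
  have ha' : a ^ p ^ s ∈ commutator G := by
    rw [← hab]
    exact Subgroup.commutator_mem_commutator (Subgroup.mem_top a) (Subgroup.mem_top b)
  -- The two coordinates of `G/G'`.
  have hcoord : ∃ (α : G →* Multiplicative (ZMod (p ^ s))) (β : G →* Multiplicative (ZMod (p ^ n))),
      α a = Multiplicative.ofAdd 1 ∧ α b = 1 ∧ β a = 1 ∧ β b = Multiplicative.ofAdd 1 := by
    have hone : ∀ k : ℕ, (Multiplicative.ofAdd (1 : ZMod k)) ^ k = 1 := fun k => by
      rw [← ofAdd_nsmul, nsmul_one, ZMod.natCast_self, ofAdd_zero]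
    refine ⟨(MetacyclicMinimal.lift (Multiplicative.ofAdd 1) 1 (hone _)
        (one_pow _)).comp e.toMonoidHom,
      (MetacyclicMinimal.lift 1 (Multiplicative.ofAdd 1) (one_pow _)
        (hone _)).comp e.toMonoidHom, ?_, ?_, ?_, ?_⟩ <;>
      simp [a, b, A, B, MetacyclicMinimal.lift]
  obtain ⟨α, β, hαa, hαb, hβa, hβb⟩ := hcoord
  have hns : n = s := by
    let π := QuotientGroup.mk' (commutator G)
    have hlift : ∀ {C : Type} [CommGroup C] (φ : G →* C) (x : G),
        QuotientGroup.lift (commutator G) φ (Abelianization.commutator_subset_ker φ) (π x) = φ x :=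
      fun _ _ => rfl
    have hπa : π a ^ p ^ s = 1 := by
      rw [← map_pow]; exact (QuotientGroup.eq_one_iff _).2 ha'
    have hπb : π b ^ p ^ n = 1 := by rw [← map_pow, hb, map_one]
    apply le_antisymm
    · exact hhom.le_of_coordinates hp (by omega) _ _ ((hlift β b).trans hβb)
        ((hlift α a).trans hαa) hπa
    · exact hhom.le_of_coordinates hp hn _ _ ((hlift α a).trans hαa)
        ((hlift β b).trans hβb) hπb
  subst hns
  have hq2 : p ^ n ≠ 2 := by
    intro h
    have hp2 : p = 2 := (Nat.prime_dvd_prime_iff_eq hp Nat.prime_two).1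
      (h ▸ dvd_pow_self p (by omega))
    have h4 := Nat.pow_le_pow_right hp.pos (by have := hm2 hp2; omega : 2 ≤ n)
    rw [h, hp2] at h4
    omega
  have hc : a ^ p ^ n ∈ exteriorCenter G := by
    refine mem_exteriorCenter_of_closure hgen ?_
    rintro x (rfl | rfl)
    · exact pow_wedge_self _ _
    · exact wedge_pow_eq_one_of_metacyclic hp hq2 ha hb hab hcenter
  have hext : exteriorCenter G = (commutator G : Set G) := by
    apply Set.Subset.antisymm
    · intro g hg
      refine mem_commutator_of_coordinates_eq_one hgen ha' (hb ▸ one_mem _) α β hαa hαb hβa hβb ?_ ?_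
      · have := alternating_eq_zero_of_mem_exteriorCenter α β hg b
        simpa [hαb, hβb] using this
      · have := alternating_eq_zero_of_mem_exteriorCenter α β hg a
        simpa [hαa, hβa] using this
    · intro g hg h
      have hnormal : (Subgroup.zpowers (a ^ p ^ n)).Normal :=
        ⟨fun x hx y => by
          rwa [Subgroup.mem_center_iff.1 (Subgroup.zpowers_le.2 hcenter hx) y,
            mul_inv_cancel_right]⟩
      have hz : g ∈ Subgroup.zpowers (a ^ p ^ n) :=
        commutator_le_of_closure_pair hgen (hab ▸ Subgroup.mem_zpowers _) hg
      have hfin : IsOfFinOrder (a ^ p ^ n) :=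
        isOfFinOrder_iff_pow_eq_one.2 ⟨p, hp.pos, by rw [← pow_mul, ← pow_succ, ha]⟩
      obtain ⟨k, rfl⟩ := hfin.mem_powers_iff_mem_zpowers.2 hz
      exact pow_wedge_eq_one (hc h) k
  refine ⟨rfl, fun hcap => hmin.1 fun x y => ?_, hext⟩
  have hxy : ⁅x, y⁆ ∈ exteriorCenter G :=
    hext ▸ Subgroup.commutator_mem_commutator (Subgroup.mem_top x) (Subgroup.mem_top y)
  exact commutatorElement_eq_one_iff_mul_comm.1 (hcap.eq_one_of_mem_exteriorCenter hxy)
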